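/- Let $\Phi$ be a quantum channel on $\mathcal M_n=M_n(\mathbb C)$, i.e. a completely positive trace-preserving linear map, and let $\mathrm{Attr}(\Phi)$ be the sum of the eigenspaces $\ker(\Phi-\lambda)$ over all eigenvalues $\lambda$ of $\Phi$ with $|\lambda|=1$. The peripheral channel $\Phi_P$ is the restriction of $\Phi$ to $\mathrm{Attr}(\Phi)$. Consider a Perez-Garcia–Wolf decomposition of $\Phi$: a unitary identification $$\mathbb C^n=\mathcal H_0^\perp\oplus\mathcal H_0,\qquad \mathcal H_0=\bigoplus_{k=1}^M\mathcal H_{k,1}\otimes\mathcal H_{k,2},$$ where $\dim\mathcal H_{k,1}=d_k\ge 1$ and $\dim\mathcal H_{k,2}=m_k$, positive definite density matrices $\rho_k$ on $\mathcal H_{k,2}$, a permutation $\pi$ of $\{1,\dots,M\}$ and unitaries $U_k:\mathcal H_{\pi(k),1}\to\mathcal H_{k,1}$ such that $$\mathrm{Attr}(\Phi)=\Big\{0\oplus\bigoplus_{k}x_k\otimes\rho_k : x_k\in\mathcal M_{d_k}\Big\},\qquad \Phi\Big(0\oplus\bigoplus_k x_k\otimes\rho_k\Big)=0\oplus\bigoplus_k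 U_kx_{\pi(k)}U_k^\dagger\otimes\rho_k .$$ Write $\rho_k\sim\rho_{\pi(k)}$ if there is a unitary $V_k:\mathcal H_{\pi(k),2}\to\mathcal H_{k,2}$ with $\rho_k=V_k\rho_{\pi(k)}V_k^\dagger$. Then: 1. If $\Phi$ is faithful (it has a fixed point of full rank), then $\mathcal H_0^\perp=0$, so $\mathcal H_0=\mathbb C^n$. 2. (Faithful or not) there is a unitary $U$ on $\mathbb C^n$ with $\Phi_P(X)=UXU^\dagger$ for all $X\in\mathrm{Attr}(\Phi)$ if and only if $\rho_k\sim\rho_{\pi(k)}$ for every $k$. 3. The same condition is necessary and sufficient for the existence of a unitary $S$ on $\mathcal H_0$ such that $U=\mathbb I_{\mathcal H_0^\perp}\oplus S$ satisfies $\Phi_P(X)=UXU^\dagger$ on $\mathrm{Attr}(\Phi)$. 4. Whenever unitaries $V_k:\mathcal H_{\pi(k),2}\to\mathcal H_{k,2}$ satisfy $\rho_k=V_k\rho_{\pi(k)}V_k^\dagger$ for every $k$, the linear operator $S$ on $\mathcal H_0$ determined by $S:\bigoplus_k\phi_k\otimes\psi_k\mapsto\bigoplus_k U_k\phi_{\pi(k)}\otimes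 V_k\psi_{\pi(k)}$ is unitary, and so is $U=\mathbb I_{\mathcal H_0^\perp}\oplus S$, which satisfies $\Phi_P(X)=UXU^\dagger$ on $\mathrm{Attr}(\Phi)$. 5. If $\Phi$ is unital ($\Phi(\mathbb I)=\mathbb I$), then $\rho_k=\mathbb I_{\mathcal H_{k,2}}/m_k$ for every $k$, and $\Phi_P(X)=UXU^\dagger$ on $\mathrm{Attr}(\Phi)$ for some unitary $U$ on $\mathbb C^n$ if and only if $m_k=m_{\pi(k)}$ for every $k$. -/

import Mathlib

open scoped Matrix Kronecker ComplexOrder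

section
-- `M_n(ℂ)` as a C⋆-algebra: operator norm and Loewner order
open scoped MatrixOrder Matrix.Norms.L2Operator CStarAlgebra

/-- A quantum channel on `M_n(ℂ)`: a completely positive, trace-preserving linear map. -/
def IsQuantumChannel {n : ℕ} (Φ : Module.End ℂ (Matrix (Fin n) (Fin n) ℂ)) : Prop :=
  (∃ Ψ : Matrix (Fin n) (Fin n) ℂ →CP Matrix (Fin n) (Fin n) ℂ, Ψ.toLinearMap = Φ) ∧
    ∀ X, (Φ X).trace = X.trace

end

/-- A channel is faithful if it has a fixed point of full rank. -/
def IsFaithful {n : ℕ} (Φ : Module.End ℂ (Matrix (Fin n) (Fin n) ℂ)) : Prop :=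
  ∃ Y, Φ Y = Y ∧ Y.rank = n

/-- The attractor subspace: the sum of the eigenspaces of all eigenvalues of modulus one. -/
def attractor {n : ℕ} (Φ : Module.End ℂ (Matrix (Fin n) (Fin n) ℂ)) :
    Submodule ℂ (Matrix (Fin n) (Fin n) ℂ) :=
  ⨆ (μ : ℂ) (_ : Φ.HasEigenvalue μ ∧ ‖μ‖ = 1), Φ.eigenspace μ

theorem map_mem_attractor {n : ℕ} (Φ : Module.End ℂ (Matrix (Fin n) (Fin n) ℂ)) :
    ∀ X ∈ attractor Φ, Φ X ∈ attractor Φ := by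
  have key : attractor Φ ≤ (attractor Φ).comap Φ := by
    refine iSup₂_le fun μ hμ X hX => ?_
    rw [Submodule.mem_comap, Module.End.mem_eigenspace_iff.mp hX]
    exact Submodule.smul_mem _ _ (Submodule.mem_iSup_of_mem μ (Submodule.mem_iSup_of_mem hμ hX))
  exact fun X hX => key hX

/-- The peripheral channel: the channel acting on its attractor subspace. -/
def peripheralChannel {n : ℕ} (Φ : Module.End ℂ (Matrix (Fin n) (Fin n) ℂ)) :
    attractor Φ →ₗ[ℂ] attractor Φ :=
  Φ.restrict (map_mem_attractor Φ)

/-- The matrix of a unitary operator between two (possibly different) finite-dimensional Hilbert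
spaces with chosen orthonormal bases. -/
def IsUnitaryMatrix {a b : Type*} [Fintype a] [Fintype b] [DecidableEq a] [DecidableEq b]
    (A : Matrix a b ℂ) : Prop :=
  Aᴴ * A = 1 ∧ A * Aᴴ = 1

/-- Unitary equivalence `A ∼ B` of operators on possibly different spaces. -/
def UnitarilyEquivalent {a b : Type*} [Fintype a] [Fintype b] [DecidableEq a] [DecidableEq b]
    (A : Matrix a a ℂ) (B : Matrix b b ℂ) : Prop :=
  ∃ V : Matrix a b ℂ, IsUnitaryMatrix V ∧ A = V * B * Vᴴ

/-- `U` implements the peripheral channel: `Φ_P(X) = U X U†` on the attractor subspace. -/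
def Implements {n : ℕ} (U : Matrix (Fin n) (Fin n) ℂ)
    (Φ : Module.End ℂ (Matrix (Fin n) (Fin n) ℂ)) : Prop :=
  ∀ X : attractor Φ, (peripheralChannel Φ X : Matrix (Fin n) (Fin n) ℂ) = U * X * Uᴴ

/-- The peripheral channel is a unitary channel. -/
def HasUnitaryPeripheralChannel {n : ℕ}
    (Φ : Module.End ℂ (Matrix (Fin n) (Fin n) ℂ)) : Prop :=
  ∃ U : Matrix (Fin n) (Fin n) ℂ, IsUnitaryMatrix U ∧ Implements U Φ

/-- Labels of an orthonormal basis of `⨁ₖ ℂ^{d k} ⊗ ℂ^{m k}`. -/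
abbrev BlockIndex {M : ℕ} (d m : Fin M → ℕ) : Type :=
  Σ k : Fin M, Fin (d k) × Fin (m k)

/-- The operator `0 ⊕ ⨁ₖ xₖ ⊗ ρₖ` on `ℂ^z ⊕ ⨁ₖ ℂ^{d k} ⊗ ℂ^{m k}`. -/
def blockOperator (z : ℕ) {M : ℕ} {d m : Fin M → ℕ}
    (x : ∀ k, Matrix (Fin (d k)) (Fin (d k)) ℂ) (ρ : ∀ k, Matrix (Fin (m k)) (Fin (m k)) ℂ) :
    Matrix (Fin z ⊕ BlockIndex d m) (Fin z ⊕ BlockIndex d m) ℂ :=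
  Matrix.fromBlocks 0 0 0 (Matrix.blockDiagonal' fun k => x k ⊗ₖ ρ k)

/-- A Perez-Garcia–Wolf decomposition of `Φ`. The unitary `W` identifies
`ℂ^z ⊕ ⨁ₖ ℂ^{d k} ⊗ ℂ^{m k}` with `ℂ^n`; the first summand corresponds to `H₀^⊥`, the rest to `H₀`.
Since `π` permutes blocks of equal `d`, the unitary `U k` is viewed as an operator
`ℂ^{d (π k)} → ℂ^{d k}`. -/
structure PeripheralDecomposition {n : ℕ} (Φ : Module.End ℂ (Matrix (Fin n) (Fin n) ℂ)) where
  /-- dimension of the zero block -/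
  z : ℕ
  /-- number of blocks -/
  M : ℕ
  /-- dimensions of the first tensor factors -/
  d : Fin M → ℕ
  /-- dimensions of the second tensor factors -/
  m : Fin M → ℕ
  d_pos : ∀ k, 0 < d k
  /-- the identification of the decomposed space with `ℂ^n` -/
  W : Matrix (Fin n) (Fin z ⊕ BlockIndex d m) ℂ
  W_unitary : IsUnitaryMatrix W
  /-- the density matrices on the second factors -/
  ρ : ∀ k, Matrix (Fin (m k)) (Fin (m k)) ℂ
  ρ_posDef : ∀ k, (ρ k).PosDef
  ρ_trace : ∀ k, (ρ k).trace = 1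
  attractor_eq : (attractor Φ : Set (Matrix (Fin n) (Fin n) ℂ)) =
    Set.range fun x : (∀ k, Matrix (Fin (d k)) (Fin (d k)) ℂ) => W * blockOperator z x ρ * Wᴴ
  /-- the permutation of the blocks -/
  π : Equiv.Perm (Fin M)
  /-- the unitaries on the first factors -/
  U : ∀ k, Matrix (Fin (d k)) (Fin (d (π k))) ℂ
  U_unitary : ∀ k, IsUnitaryMatrix (U k)
  map_eq : ∀ x : (∀ k, Matrix (Fin (d k)) (Fin (d k)) ℂ),
    Φ (W * blockOperator z x ρ * Wᴴ) =
      W * blockOperator z (fun k => U k * x (π k) * (U k)ᴴ) ρ * Wᴴ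

namespace PeripheralDecomposition

/-- The extension `1 ⊕ S` to `ℂ^n` of an operator `S` on `H₀ = ⨁ₖ ℂ^{d k} ⊗ ℂ^{m k}`. -/
def extend {n : ℕ} {Φ : Module.End ℂ (Matrix (Fin n) (Fin n) ℂ)} (D : PeripheralDecomposition Φ)
    (S : Matrix (BlockIndex D.d D.m) (BlockIndex D.d D.m) ℂ) : Matrix (Fin n) (Fin n) ℂ :=
  D.W * Matrix.fromBlocks (1 : Matrix (Fin D.z) (Fin D.z) ℂ) 0 0 S * D.Wᴴ

/-- The matrix of the linear operator on `H₀` determined by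
`⨁ₖ φₖ ⊗ ψₖ ↦ ⨁ₖ U k φ_{π k} ⊗ V k ψ_{π k}`. -/
noncomputable def intertwiner {n : ℕ} {Φ : Module.End ℂ (Matrix (Fin n) (Fin n) ℂ)}
    (D : PeripheralDecomposition Φ)
    (V : ∀ k, Matrix (Fin (D.m k)) (Fin (D.m (D.π k))) ℂ) :
    Matrix (BlockIndex D.d D.m) (BlockIndex D.d D.m) ℂ :=
  LinearMap.toMatrix'
    { toFun := fun v p => ((D.U p.1 ⊗ₖ V p.1) *ᵥ fun q => v ⟨D.π p.1, q⟩) p.2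
      map_add' := fun v w => by
        funext p
        exact congrFun (Matrix.mulVec_add _ (fun q => v ⟨D.π p.1, q⟩)
          (fun q => w ⟨D.π p.1, q⟩)) p.2
      map_smul' := fun c v => by
        funext p
        exact congrFun (Matrix.mulVec_smul _ c (fun q => v ⟨D.π p.1, q⟩)) p.2 }

end PeripheralDecomposition

/-!
Everything takes place in the coordinates of the decomposition: conjugation by the unitary `W` turns
the attractor into the block operators `0 ⊕ ⨁ₖ xₖ ⊗ ρₖ`.

*Necessity.* Suppose a unitary `T` implements the peripheral map. Fix `k` and evaluate at the block
operator whose only nonzero component is the rank-one projection `e e†` in block `π k`. With the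
isometries `J ψ = e ⊗ ψ` into block `π k` and `L ψ = U k e ⊗ ψ` into block `k`, the implementation
identity becomes `T J ρ_{π k} J† T† = L ρₖ L†`. As both density matrices are invertible, the
isometries `T J` and `L` have the same range, so `V = L† T J` is unitary, and it carries `ρ_{π k}`
to `ρₖ`. No spectral theory is needed (`unitarilyEquivalent_of_isometries`).

*Sufficiency.* The intertwiner `S` is a block diagonal matrix with rectangular blocks `U k ⊗ V k`,
followed by the relabelling of blocks by `π`. Hence conjugation by `S` sends `⨁ₖ Aₖ` to
`⨁ₖ (U k ⊗ V k) A_{π k} (U k ⊗ V k)†` (`intertwiner_conj_blockDiagonal'`). This gives unitarity for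
`Aₖ = 1`, and the implementation identity for `Aₖ = xₖ ⊗ ρₖ`.

Fixed points lie in the attractor. A fixed point of full rank therefore leaves no room for a zero
block, and if `1` is fixed then `xₖ ⊗ ρₖ = 1` for some `x`, which forces `ρₖ` to be scalar; two
normalized scalar matrices are unitarily equivalent exactly when they have the same size.
-/

/-! ### Unitary matrices between different index types -/

section Unitary

variable {a b c : Type*} [Fintype a] [Fintype b] [Fintype c]
  [DecidableEq a] [DecidableEq b] [DecidableEq c]

theorem IsUnitaryMatrix.conjTranspose {A : Matrix a b ℂ} (hA : IsUnitaryMatrix A) :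
    IsUnitaryMatrix Aᴴ := by
  simpa [IsUnitaryMatrix] using And.intro hA.2 hA.1

theorem IsUnitaryMatrix.mul {A : Matrix a b ℂ} {B : Matrix b c ℂ} (hA : IsUnitaryMatrix A)
    (hB : IsUnitaryMatrix B) : IsUnitaryMatrix (A * B) := by
  constructor
  · calc (A * B)ᴴ * (A * B) = Bᴴ * (Aᴴ * A) * B := by
          simp only [Matrix.conjTranspose_mul, Matrix.mul_assoc]
      _ = 1 := by rw [hA.1, Matrix.mul_one, hB.1]
  · calc A * B * (A * B)ᴴ = A * (B * Bᴴ) * Aᴴ := by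
          simp only [Matrix.conjTranspose_mul, Matrix.mul_assoc]
      _ = 1 := by rw [hB.2, Matrix.mul_one, hA.2]

theorem IsUnitaryMatrix.eq_of_conj_eq {A : Matrix a b ℂ} (hA : IsUnitaryMatrix A)
    {X Y : Matrix b b ℂ} (h : A * X * Aᴴ = A * Y * Aᴴ) : X = Y := by
  have key (X : Matrix b b ℂ) : Aᴴ * (A * X * Aᴴ) * A = X := by
    calc Aᴴ * (A * X * Aᴴ) * A = (Aᴴ * A) * X * (Aᴴ * A) := by simp only [Matrix.mul_assoc]
      _ = X := by rw [hA.1, Matrix.one_mul, Matrix.mul_one]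
  rw [← key X, h, key Y]

theorem IsUnitaryMatrix.card_eq {A : Matrix a b ℂ} (hA : IsUnitaryMatrix A) :
    Fintype.card a = Fintype.card b := by
  have h := Matrix.trace_mul_comm A Aᴴ
  rw [hA.1, hA.2, Matrix.trace_one, Matrix.trace_one] at h
  exact_mod_cast h

/-- A unitary carrying `J ρ J†` to `L σ L†`, where `J` and `L` are isometries and `ρ` and `σ` are
invertible, restricts to a unitary equivalence of `ρ` and `σ`. -/
theorem unitarilyEquivalent_of_isometries {J : Matrix c a ℂ} {L : Matrix c b ℂ}
    {T : Matrix c c ℂ} {ρ : Matrix a a ℂ} {σ : Matrix b b ℂ} (hT : IsUnitaryMatrix T)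
    (hJ : Jᴴ * J = 1) (hL : Lᴴ * L = 1) (hρ : IsUnit ρ) (hσ : IsUnit σ)
    (h : T * (J * ρ * Jᴴ) * Tᴴ = L * σ * Lᴴ) : UnitarilyEquivalent σ ρ := by
  obtain ⟨K, hK⟩ : ∃ K, K = T * J := ⟨_, rfl⟩
  have hKK : Kᴴ * K = 1 := by
    calc Kᴴ * K = Jᴴ * (Tᴴ * T) * J := by
          simp only [hK, Matrix.conjTranspose_mul, Matrix.mul_assoc]
      _ = 1 := by rw [hT.1, Matrix.mul_one, hJ]
  have h' : K * ρ * Kᴴ = L * σ * Lᴴ := by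
    rw [← h]; simp only [hK, Matrix.conjTranspose_mul, Matrix.mul_assoc]
  -- `L L†` projects onto a space containing the range of `K ρ`, hence that of `K`; and vice versa.
  have hLK : L * Lᴴ * K = K := by
    have e : K * ρ = L * σ * Lᴴ * K := by
      rw [← h', Matrix.mul_assoc (K * ρ), hKK, Matrix.mul_one]
    have : L * Lᴴ * K * ρ = K * ρ := by
      calc L * Lᴴ * K * ρ = L * (Lᴴ * L) * σ * Lᴴ * K := by
            rw [Matrix.mul_assoc _ K, e]; simp only [Matrix.mul_assoc]
        _ = K * ρ := by rw [hL, Matrix.mul_one, e]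
    obtain ⟨r, hr⟩ := hρ.exists_right_inv
    simpa only [Matrix.mul_assoc, hr, Matrix.mul_one] using congrArg (· * r) this
  have hKL : K * Kᴴ * L = L := by
    have e : L * σ = K * ρ * Kᴴ * L := by
      rw [h', Matrix.mul_assoc (L * σ), hL, Matrix.mul_one]
    have : K * Kᴴ * L * σ = L * σ := by
      calc K * Kᴴ * L * σ = K * (Kᴴ * K) * ρ * Kᴴ * L := by
            rw [Matrix.mul_assoc _ L, e]; simp only [Matrix.mul_assoc]
        _ = L * σ := by rw [hKK, Matrix.mul_one, e]
    obtain ⟨r, hr⟩ := hσ.exists_right_inv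
    simpa only [Matrix.mul_assoc, hr, Matrix.mul_one] using congrArg (· * r) this
  refine ⟨Lᴴ * K, ⟨?_, ?_⟩, ?_⟩
  · calc (Lᴴ * K)ᴴ * (Lᴴ * K) = Kᴴ * (L * Lᴴ * K) := by
          simp only [Matrix.conjTranspose_mul, Matrix.conjTranspose_conjTranspose,
            Matrix.mul_assoc]
      _ = 1 := by rw [hLK, hKK]
  · calc Lᴴ * K * (Lᴴ * K)ᴴ = Lᴴ * (K * Kᴴ * L) := by
          simp only [Matrix.conjTranspose_mul, Matrix.conjTranspose_conjTranspose,
            Matrix.mul_assoc]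
      _ = 1 := by rw [hKL, hL]
  · calc σ = (Lᴴ * L) * σ * (Lᴴ * L) := by rw [hL, Matrix.one_mul, Matrix.mul_one]
      _ = Lᴴ * (K * ρ * Kᴴ) * L := by rw [h']; simp only [Matrix.mul_assoc]
      _ = Lᴴ * K * ρ * (Lᴴ * K)ᴴ := by
          simp only [Matrix.conjTranspose_mul, Matrix.conjTranspose_conjTranspose,
            Matrix.mul_assoc]

end Unitary

/-- Normalized scalar matrices are unitarily equivalent exactly when their sizes agree. -/
theorem unitarilyEquivalent_inv_smul_one_iff {p q : ℕ} :
    UnitarilyEquivalent ((p : ℂ)⁻¹ • (1 : Matrix (Fin p) (Fin p) ℂ))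
      ((q : ℂ)⁻¹ • (1 : Matrix (Fin q) (Fin q) ℂ)) ↔ p = q := by
  constructor
  · rintro ⟨V, hV, -⟩
    simpa using hV.card_eq
  · rintro rfl
    exact ⟨1, by simp [IsUnitaryMatrix], by simp⟩

/-! ### Block operators -/

section Block

variable {M : ℕ} {d m : Fin M → ℕ} (z : ℕ)

/-- The operator `ψ ↦ v ⊗ ψ` from `ℂ^{m j}` into the block `j` of `ℂ^z ⊕ ⨁ₖ ℂ^{d k} ⊗ ℂ^{m k}`. -/
noncomputable def blockEmbedding (m : Fin M → ℕ) (j : Fin M) (v : Fin (d j) → ℂ) :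
    Matrix (Fin z ⊕ BlockIndex d m) (Fin (m j)) ℂ :=
  Matrix.fromRows 0 (Matrix.of fun p c =>
    (Pi.single j (fun q => v q.1 * if q.2 = c then 1 else 0) :
      ∀ k, Fin (d k) × Fin (m k) → ℂ) p.1 p.2)

theorem blockEmbedding_isometry {j : Fin M} {v : Fin (d j) → ℂ} (hv : star v ⬝ᵥ v = 1) :
    (blockEmbedding z m j v)ᴴ * blockEmbedding z m j v = 1 := by
  ext c c'
  -- Only block `j` contributes to the inner product of two columns.
  rw [Matrix.mul_apply, Fintype.sum_sum_type, Fintype.sum_sigma]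
  rw [Finset.sum_eq_single j]
  · simp only [blockEmbedding, Matrix.conjTranspose_apply, Matrix.fromRows_apply_inl,
      Matrix.fromRows_apply_inr, Matrix.of_apply, Pi.single_eq_same, Fintype.sum_prod_type,
      Matrix.zero_apply, mul_zero, Finset.sum_const_zero, zero_add]
    have hv' : ∑ i, star (v i) * v i = 1 := hv
    have hb (i : Fin (d j)) : (∑ b : Fin (m j), star (v i * if b = c then 1 else 0) *
        (v i * if b = c' then 1 else 0)) = star (v i) * v i * if c = c' then 1 else 0 := by
      rw [Finset.sum_eq_single c (fun b _ hb => by simp [hb]) (by simp), if_pos rfl, mul_one,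
        mul_assoc]
    simp_rw [hb]
    rw [← Finset.sum_mul, hv', one_mul, Matrix.one_apply]
  · intro k _ hk
    simp [blockEmbedding, Pi.single_eq_of_ne hk]
  · simp

/-- A block operator with a single rank-one component `v v† ⊗ ρ j` factors through the block
embedding of `v`. -/
theorem blockOperator_single_vecMulVec (ρ : ∀ k, Matrix (Fin (m k)) (Fin (m k)) ℂ) (j : Fin M)
    (v : Fin (d j) → ℂ) :
    blockOperator z (Pi.single j (Matrix.vecMulVec v (star v))) ρ =
      blockEmbedding z m j v * ρ j * (blockEmbedding z m j v)ᴴ := by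
  ext p q
  rw [Matrix.mul_apply]
  rcases p with p | ⟨k, p⟩
  · rcases q with q | q <;> simp [blockOperator, blockEmbedding, Matrix.mul_apply]
  rcases q with q | ⟨l, q⟩
  · simp [blockOperator, blockEmbedding]
  by_cases hk : k = j
  · subst hk
    by_cases hl : l = k
    · subst hl
      simp [blockOperator, blockEmbedding, Matrix.mul_apply, Matrix.vecMulVec_apply,
        apply_ite star]
      ring
    · simp [blockOperator, blockEmbedding, Pi.single_eq_of_ne hl,
        Matrix.blockDiagonal'_apply_ne _ _ _ (Ne.symm hl)]
  · by_cases hl : k = l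
    · subst hl
      simp [blockOperator, blockEmbedding, Pi.single_eq_of_ne hk, Matrix.mul_apply]
    · simp [blockOperator, blockEmbedding, Pi.single_eq_of_ne hk, Matrix.mul_apply,
        Matrix.blockDiagonal'_apply_ne _ _ _ hl]

/-- If a block operator is the identity, then each density matrix is the maximally mixed one. -/
theorem eq_inv_smul_one_of_blockOperator_eq_one {x : ∀ k, Matrix (Fin (d k)) (Fin (d k)) ℂ}
    {ρ : ∀ k, Matrix (Fin (m k)) (Fin (m k)) ℂ} (h : blockOperator z x ρ = 1) {k : Fin M}
    (hd : 0 < d k) (hρ : (ρ k).trace = 1) :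
    ρ k = ((m k : ℂ)⁻¹) • (1 : Matrix (Fin (m k)) (Fin (m k)) ℂ) := by
  -- A diagonal entry of `x k` is a scalar `s` with `s • ρ k = 1`.
  have key : x k ⟨0, hd⟩ ⟨0, hd⟩ • ρ k = 1 := by
    ext b b'
    have := congrFun (congrFun h (.inr ⟨k, ⟨0, hd⟩, b⟩)) (.inr ⟨k, ⟨0, hd⟩, b'⟩)
    simpa [blockOperator, Matrix.one_apply] using this
  have hs : x k ⟨0, hd⟩ ⟨0, hd⟩ = m k := by
    simpa [Matrix.trace_smul, hρ] using congrArg Matrix.trace key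
  rw [hs] at key
  have hm : (m k : ℂ) ≠ 0 := by
    intro h0
    have : IsEmpty (Fin (m k)) := by
      rw [Nat.cast_eq_zero.mp h0]; infer_instance
    simp [Matrix.trace] at hρ
  rw [← key, smul_smul, inv_mul_cancel₀ hm, one_smul]

end Block

/-! ### Fixed points and the attractor -/

theorem mem_attractor_of_fixed {n : ℕ} {Φ : Module.End ℂ (Matrix (Fin n) (Fin n) ℂ)}
    {Y : Matrix (Fin n) (Fin n) ℂ} (hY : Φ Y = Y) : Y ∈ attractor Φ := by
  by_cases h0 : Y = 0
  · rw [h0]; exact Submodule.zero_mem _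
  · have hmem : Y ∈ Φ.eigenspace 1 := by rw [Module.End.mem_eigenspace_iff, hY, one_smul]
    have hev : Φ.HasEigenvalue 1 := Module.End.hasEigenvalue_of_hasEigenvector ⟨hmem, h0⟩
    exact Submodule.mem_iSup_of_mem 1 (Submodule.mem_iSup_of_mem ⟨hev, norm_one⟩ hmem)

namespace PeripheralDecomposition

variable {n : ℕ} {Φ : Module.End ℂ (Matrix (Fin n) (Fin n) ℂ)} (D : PeripheralDecomposition Φ)

theorem mem_attractor_iff {X : Matrix (Fin n) (Fin n) ℂ} :
    X ∈ attractor Φ ↔ ∃ x : (∀ k, Matrix (Fin (D.d k)) (Fin (D.d k)) ℂ),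
      D.W * blockOperator D.z x D.ρ * D.Wᴴ = X := by
  rw [← SetLike.mem_coe, D.attractor_eq, Set.mem_range]

/-- Implementation of the peripheral channel, read in the coordinates of the decomposition. -/
theorem implements_conj_iff
    {T : Matrix (Fin D.z ⊕ BlockIndex D.d D.m) (Fin D.z ⊕ BlockIndex D.d D.m) ℂ} :
    Implements (D.W * T * D.Wᴴ) Φ ↔ ∀ x, T * blockOperator D.z x D.ρ * Tᴴ =
      blockOperator D.z (fun k => D.U k * x (D.π k) * (D.U k)ᴴ) D.ρ := by
  have key (x) : D.W * T * D.Wᴴ * (D.W * blockOperator D.z x D.ρ * D.Wᴴ) * (D.W * T * D.Wᴴ)ᴴ =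
      D.W * (T * blockOperator D.z x D.ρ * Tᴴ) * D.Wᴴ := by
    calc _ = D.W * T * (D.Wᴴ * D.W) * blockOperator D.z x D.ρ * (D.Wᴴ * D.W) * Tᴴ * D.Wᴴ := by
          simp only [Matrix.conjTranspose_mul, Matrix.conjTranspose_conjTranspose,
            Matrix.mul_assoc]
      _ = _ := by rw [D.W_unitary.1]; simp only [Matrix.mul_one, Matrix.mul_assoc]
  constructor
  · intro h x
    have hx := h ⟨_, D.mem_attractor_iff.mpr ⟨x, rfl⟩⟩
    refine D.W_unitary.eq_of_conj_eq ?_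
    rw [← key, ← D.map_eq]
    exact hx.symm
  · rintro h ⟨X, hX⟩
    obtain ⟨x, rfl⟩ := D.mem_attractor_iff.mp hX
    change Φ _ = D.W * T * D.Wᴴ * (D.W * blockOperator D.z x D.ρ * D.Wᴴ) * (D.W * T * D.Wᴴ)ᴴ
    rw [key, h, ← D.map_eq]
    rfl

theorem z_eq_zero_of_isFaithful (h : IsFaithful Φ) : D.z = 0 := by
  obtain ⟨Y, hY, hrank⟩ := h
  obtain ⟨x, rfl⟩ := D.mem_attractor_iff.mp (mem_attractor_of_fixed hY)
  have hunit : IsUnit (D.W * blockOperator D.z x D.ρ * D.Wᴴ) := by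
    rw [← Matrix.linearIndependent_cols_iff_isUnit, linearIndependent_iff_card_eq_finrank_span,
      Fintype.card_fin, Set.finrank, ← Matrix.rank_eq_finrank_span_cols, hrank]
  obtain ⟨R, hR⟩ := hunit.exists_right_inv
  have hone : blockOperator D.z x D.ρ * (D.Wᴴ * R * D.W) = 1 := by
    refine D.W_unitary.eq_of_conj_eq ?_
    calc D.W * (blockOperator D.z x D.ρ * (D.Wᴴ * R * D.W)) * D.Wᴴ
        = D.W * blockOperator D.z x D.ρ * D.Wᴴ * R * (D.W * D.Wᴴ) := by
          simp only [Matrix.mul_assoc]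
      _ = _ := by rw [hR, D.W_unitary.2, Matrix.mul_one, Matrix.mul_one, D.W_unitary.2]
  -- A row of an invertible matrix cannot vanish.
  by_contra hz
  let i : Fin D.z ⊕ BlockIndex D.d D.m := .inl ⟨0, Nat.pos_of_ne_zero hz⟩
  have hrow (q) : blockOperator D.z x D.ρ i q = 0 := by
    rcases q with q | q <;> simp [i, blockOperator]
  have := congrFun (congrFun hone i) i
  simp [Matrix.mul_apply (M := blockOperator D.z x D.ρ), hrow] at this

/-! ### Necessity -/

theorem unitarilyEquivalent_of_hasUnitaryPeripheralChannel (h : HasUnitaryPeripheralChannel Φ)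
    (k : Fin D.M) : UnitarilyEquivalent (D.ρ k) (D.ρ (D.π k)) := by
  obtain ⟨U, hU, hImp⟩ := h
  set T := D.Wᴴ * U * D.W with hT
  have hTU : IsUnitaryMatrix T := (D.W_unitary.conjTranspose.mul hU).mul D.W_unitary
  have hUT : D.W * T * D.Wᴴ = U := by
    calc D.W * T * D.Wᴴ = (D.W * D.Wᴴ) * U * (D.W * D.Wᴴ) := by
          simp only [hT, Matrix.mul_assoc]
      _ = U := by rw [D.W_unitary.2, Matrix.one_mul, Matrix.mul_one]
  rw [← hUT, D.implements_conj_iff] at hImp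
  -- Any unit vector would do; one exists because the block has positive dimension.
  let e : Fin (D.d (D.π k)) → ℂ := Pi.single ⟨0, D.d_pos _⟩ 1
  have he : star e ⬝ᵥ e = 1 := by simp [e]
  have hUe : star (D.U k *ᵥ e) ⬝ᵥ (D.U k *ᵥ e) = 1 := by
    rw [Matrix.star_mulVec, ← Matrix.dotProduct_mulVec, Matrix.mulVec_mulVec, (D.U_unitary k).1,
      Matrix.one_mulVec, he]
  have hsingle : (fun l => D.U l *
      (Pi.single (D.π k) (Matrix.vecMulVec e (star e)) :
        ∀ l, Matrix (Fin (D.d l)) (Fin (D.d l)) ℂ) (D.π l) * (D.U l)ᴴ) =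
      Pi.single k (Matrix.vecMulVec (D.U k *ᵥ e) (star (D.U k *ᵥ e))) := by
    funext l
    by_cases hl : l = k
    · subst hl
      rw [Pi.single_eq_same, Pi.single_eq_same, Matrix.mul_vecMulVec, Matrix.vecMulVec_mul,
        Matrix.star_mulVec]
    · rw [Pi.single_eq_of_ne hl, Pi.single_eq_of_ne (D.π.injective.ne hl), Matrix.mul_zero,
        Matrix.zero_mul]
  have hx := hImp (Pi.single (D.π k) (Matrix.vecMulVec e (star e)))
  rw [hsingle, blockOperator_single_vecMulVec, blockOperator_single_vecMulVec] at hx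
  exact unitarilyEquivalent_of_isometries hTU (blockEmbedding_isometry _ he)
    (blockEmbedding_isometry _ hUe) (D.ρ_posDef _).isUnit (D.ρ_posDef _).isUnit hx

/-! ### Sufficiency -/

theorem isUnitaryMatrix_extend {S : Matrix (BlockIndex D.d D.m) (BlockIndex D.d D.m) ℂ}
    (hS : IsUnitaryMatrix S) : IsUnitaryMatrix (D.extend S) := by
  refine (D.W_unitary.mul ⟨?_, ?_⟩).mul D.W_unitary.conjTranspose
  · simp [Matrix.fromBlocks_conjTranspose, Matrix.fromBlocks_multiply, hS.1]
  · simp [Matrix.fromBlocks_conjTranspose, Matrix.fromBlocks_multiply, hS.2]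

/-- Conjugation by the intertwiner permutes the blocks of a block diagonal operator and conjugates
each of them by `U k ⊗ V k`. -/
theorem intertwiner_conj_blockDiagonal' (V : ∀ k, Matrix (Fin (D.m k)) (Fin (D.m (D.π k))) ℂ)
    (A : ∀ k, Matrix (Fin (D.d k) × Fin (D.m k)) (Fin (D.d k) × Fin (D.m k)) ℂ) :
    D.intertwiner V * Matrix.blockDiagonal' A * (D.intertwiner V)ᴴ =
      Matrix.blockDiagonal' fun k => (D.U k ⊗ₖ V k) * A (D.π k) * (D.U k ⊗ₖ V k)ᴴ := by
  let e : (Σ k, Fin (D.d (D.π k)) × Fin (D.m (D.π k))) ≃ BlockIndex D.d D.m :=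
    Equiv.sigmaCongrLeft (β := fun k => Fin (D.d k) × Fin (D.m k)) D.π
  have he (k q) : e ⟨k, q⟩ = ⟨D.π k, q⟩ := rfl
  have hS : (D.intertwiner V).submatrix id e = Matrix.blockDiagonal' fun k => D.U k ⊗ₖ V k := by
    ext ⟨k, p⟩ ⟨l, q⟩
    rw [Matrix.submatrix_apply, he, id, intertwiner, LinearMap.toMatrix'_apply]
    by_cases hkl : k = l
    · subst hkl
      have : (fun r => (Pi.single (⟨D.π k, q⟩ : BlockIndex D.d D.m) (1 : ℂ) :
          BlockIndex D.d D.m → ℂ) ⟨D.π k, r⟩) = Pi.single q 1 := by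
        funext r; simp [Pi.single_apply]
      simp [this]
    · have hne : D.π k ≠ D.π l := D.π.injective.ne hkl
      have : (fun r => (Pi.single (⟨D.π l, q⟩ : BlockIndex D.d D.m) (1 : ℂ) :
          BlockIndex D.d D.m → ℂ) ⟨D.π k, r⟩) = 0 := by
        funext r; simp [hne]
      simp [this, Matrix.blockDiagonal'_apply_ne _ _ _ hkl]
  have hA : (Matrix.blockDiagonal' A).submatrix e e =
      Matrix.blockDiagonal' fun k => A (D.π k) := by
    ext ⟨k, p⟩ ⟨l, q⟩
    rw [Matrix.submatrix_apply, he, he]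
    by_cases hkl : k = l
    · subst hkl
      simp
    · rw [Matrix.blockDiagonal'_apply_ne _ _ _ hkl,
        Matrix.blockDiagonal'_apply_ne _ _ _ (D.π.injective.ne hkl)]
  calc D.intertwiner V * Matrix.blockDiagonal' A * (D.intertwiner V)ᴴ
      = (D.intertwiner V).submatrix id e * (Matrix.blockDiagonal' A).submatrix e e *
          ((D.intertwiner V).submatrix id e)ᴴ := by
        rw [Matrix.conjTranspose_submatrix, Matrix.submatrix_mul_equiv,
          Matrix.submatrix_mul_equiv, Matrix.submatrix_id_id]
    _ = _ := by
        rw [hS, hA, Matrix.blockDiagonal'_conjTranspose, ← Matrix.blockDiagonal'_mul,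
          ← Matrix.blockDiagonal'_mul]

theorem isUnitaryMatrix_intertwiner {V : ∀ k, Matrix (Fin (D.m k)) (Fin (D.m (D.π k))) ℂ}
    (hV : ∀ k, IsUnitaryMatrix (V k)) : IsUnitaryMatrix (D.intertwiner V) := by
  have h : D.intertwiner V * (D.intertwiner V)ᴴ = 1 := by
    have key := D.intertwiner_conj_blockDiagonal' V 1
    rw [Matrix.blockDiagonal'_one, Matrix.mul_one] at key
    rw [key, ← Matrix.blockDiagonal'_one]
    congr 1
    funext k
    rw [Pi.one_apply, Matrix.mul_one, Matrix.conjTranspose_kronecker, ← Matrix.mul_kronecker_mul,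
      (D.U_unitary k).2, (hV k).2, Matrix.one_kronecker_one, Pi.one_apply]
  exact ⟨mul_eq_one_comm.mp h, h⟩

theorem implements_extend_intertwiner {V : ∀ k, Matrix (Fin (D.m k)) (Fin (D.m (D.π k))) ℂ}
    (hV : ∀ k, D.ρ k = V k * D.ρ (D.π k) * (V k)ᴴ) :
    Implements (D.extend (D.intertwiner V)) Φ := by
  refine D.implements_conj_iff.mpr fun x => ?_
  simp only [blockOperator, Matrix.fromBlocks_conjTranspose, Matrix.fromBlocks_multiply,
    Matrix.conjTranspose_zero, Matrix.mul_zero, Matrix.zero_mul, add_zero, zero_add,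
    intertwiner_conj_blockDiagonal']
  congr 2
  funext k
  rw [Matrix.conjTranspose_kronecker, ← Matrix.mul_kronecker_mul, ← Matrix.mul_kronecker_mul,
    ← hV k]

theorem exists_extend_of_unitarilyEquivalent
    (h : ∀ k, UnitarilyEquivalent (D.ρ k) (D.ρ (D.π k))) :
    ∃ S : Matrix (BlockIndex D.d D.m) (BlockIndex D.d D.m) ℂ,
      IsUnitaryMatrix S ∧ Implements (D.extend S) Φ := by
  choose V hV hρ using h
  exact ⟨D.intertwiner V, D.isUnitaryMatrix_intertwiner hV, D.implements_extend_intertwiner hρ⟩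

theorem hasUnitaryPeripheralChannel_of_extend
    (h : ∃ S : Matrix (BlockIndex D.d D.m) (BlockIndex D.d D.m) ℂ,
      IsUnitaryMatrix S ∧ Implements (D.extend S) Φ) : HasUnitaryPeripheralChannel Φ := by
  obtain ⟨S, hS, hImp⟩ := h
  exact ⟨D.extend S, D.isUnitaryMatrix_extend hS, hImp⟩

theorem hasUnitaryPeripheralChannel_iff :
    HasUnitaryPeripheralChannel Φ ↔ ∀ k, UnitarilyEquivalent (D.ρ k) (D.ρ (D.π k)) :=
  ⟨D.unitarilyEquivalent_of_hasUnitaryPeripheralChannel, fun h =>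
    D.hasUnitaryPeripheralChannel_of_extend (D.exists_extend_of_unitarilyEquivalent h)⟩

/-! ### Unital channels -/

theorem ρ_eq_of_map_one (h : Φ 1 = 1) (k : Fin D.M) :
    D.ρ k = ((D.m k : ℂ)⁻¹) • (1 : Matrix (Fin (D.m k)) (Fin (D.m k)) ℂ) := by
  obtain ⟨x, hx⟩ := D.mem_attractor_iff.mp (mem_attractor_of_fixed h)
  refine eq_inv_smul_one_of_blockOperator_eq_one D.z (D.W_unitary.eq_of_conj_eq ?_) (D.d_pos k)
    (D.ρ_trace k) (x := x)
  rw [hx, Matrix.mul_one, D.W_unitary.2]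

end PeripheralDecomposition

theorem mainTheorem1 {n : ℕ} (Φ : Module.End ℂ (Matrix (Fin n) (Fin n) ℂ))
    (hΦ : IsQuantumChannel Φ) (D : PeripheralDecomposition Φ) :
    -- in the faithful case there is no zero block
    (IsFaithful Φ → D.z = 0) ∧
    -- the characterization, with a unitary on the whole space
    (HasUnitaryPeripheralChannel Φ ↔ ∀ k, UnitarilyEquivalent (D.ρ k) (D.ρ (D.π k))) ∧
    -- the characterization, with a unitary on the support space, extended by the identity
    ((∃ S : Matrix (BlockIndex D.d D.m) (BlockIndex D.d D.m) ℂ,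
        IsUnitaryMatrix S ∧ Implements (D.extend S) Φ) ↔
      ∀ k, UnitarilyEquivalent (D.ρ k) (D.ρ (D.π k))) ∧
    -- any choice of intertwiners gives an explicit implementing unitary
    (∀ V : ∀ k, Matrix (Fin (D.m k)) (Fin (D.m (D.π k))) ℂ,
      (∀ k, IsUnitaryMatrix (V k) ∧ D.ρ k = V k * D.ρ (D.π k) * (V k)ᴴ) →
        IsUnitaryMatrix (D.intertwiner V) ∧ IsUnitaryMatrix (D.extend (D.intertwiner V)) ∧
          Implements (D.extend (D.intertwiner V)) Φ) ∧
    -- the unital case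
    (Φ 1 = 1 →
      (∀ k, D.ρ k = ((D.m k : ℂ)⁻¹) • (1 : Matrix (Fin (D.m k)) (Fin (D.m k)) ℂ)) ∧
      (HasUnitaryPeripheralChannel Φ ↔ ∀ k, D.m k = D.m (D.π k))) := by
  refine ⟨D.z_eq_zero_of_isFaithful, D.hasUnitaryPeripheralChannel_iff,
    ⟨fun h => D.hasUnitaryPeripheralChannel_iff.mp (D.hasUnitaryPeripheralChannel_of_extend h),
      D.exists_extend_of_unitarilyEquivalent⟩,
    fun V hV => ?_, fun h1 => ⟨D.ρ_eq_of_map_one h1, ?_⟩⟩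
  · have hS := D.isUnitaryMatrix_intertwiner fun k => (hV k).1
    exact ⟨hS, D.isUnitaryMatrix_extend hS, D.implements_extend_intertwiner fun k => (hV k).2⟩
  · rw [D.hasUnitaryPeripheralChannel_iff]
    refine forall_congr' fun k => ?_
    rw [D.ρ_eq_of_map_one h1 k, D.ρ_eq_of_map_one h1 (D.π k),
      unitarilyEquivalent_inv_smul_one_iff]
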